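/- A Polish topometric group is a triple $(G,\tau,\partial)$ where $(G,\tau)$ is a topological group whose topology is Polish, and $\partial$ is a bi-invariant distance on $G$ whose topology refines $\tau$ and which is $\tau$-lower semi-continuous, i.e. $\{(x,y)\in G^2:\partial(x,y)\le r\}$ is $\tau\times\tau$-closed for every real $r$. For a set $X$ with a distance $\rho$, $A\subseteq X$ and $\varepsilon>0$, write $(A)_\varepsilon=\{x\in X:\rho(x,A)<\varepsilon\}$. The group $(G,\tau,\partial)$ has ample generics if for every $n\in\mathbb N$ and $\varepsilon>0$ there is $\bar x\in G^n$ such that $(G\cdot\bar x)_\varepsilon$ is co-meagre in $G^n$, where $G\cdot\bar x=\{(gx_1g^{-1},\dots,gx_ng^{-1}):g\in G\}$ is the diagonal conjugacy class of $\bar x$, and $G^n$ carries the product topology and the supremum distance. A set $A\subseteq G$ is symmetric if $A^{-1}=A$, and $\sigma$-syndetic if $G$ is covered by countably many left translates of $A$. Theorem. Let $(G,\tau,\partial)$ be a Polish topometric group with ample generics. Then $G$ is Steinhaus with exponent $10$; that is, for every symmetric $\sigma$-syndetic set $A\subseteq G$ and every $\varepsilon>0$, the identity $1_G$ lies in the $\tau$-interior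 of $(A^{10})_\varepsilon$, where $A^{10}$ is the set of all products of ten elements of $A$ and $(A^{10})_\varepsilon$ is taken with respect to $\partial$. -/

import Mathlib

open scoped Pointwise

/-- `(X, τ, d)` is a topometric space, where `τ` is the ambient topology of `X`: `d` is a distance
on `X`, its topology refines `τ`, and `d` is `τ`-lower semi-continuous.  The distance is a plain
function (rather than a `MetricSpace` instance) because `X` already carries the topology `τ`,
which in general is not the topology of `d`. -/
structure IsTopometricSpace {X : Type*} [TopologicalSpace X] (d : X → X → ℝ) : Prop where
  eq_zero_iff : ∀ x y, d x y = 0 ↔ x = y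
  symm : ∀ x y, d x y = d y x
  triangle : ∀ x y z, d x z ≤ d x y + d y z
  refines : ∀ U : Set X, IsOpen U → ∀ x ∈ U, ∃ ε : ℝ, 0 < ε ∧ ∀ y, d x y < ε → y ∈ U
  isClosed_le : ∀ r : ℝ, IsClosed {p : X × X | d p.1 p.2 ≤ r}

/-- `(G, τ, d)` is a topometric group: a topometric space such that `(G, τ)` is a topological
group and `d` is bi-invariant. -/
structure IsTopometricGroup {G : Type*} [Group G] [TopologicalSpace G] (d : G → G → ℝ) : Prop
    extends IsTopometricSpace d, IsTopologicalGroup G where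
  mul_left_invariant : ∀ g x y, d (g * x) (g * y) = d x y
  mul_right_invariant : ∀ g x y, d (x * g) (y * g) = d x y

/-- `(A)_ε = {x | d(x, A) < ε}`, where `d(x, A)` is the infimum of `d x a` over `a ∈ A`
(which is `+∞` for empty `A`). -/
def dThickening {X : Type*} (d : X → X → ℝ) (ε : ℝ) (A : Set X) : Set X :=
  {x | ∃ a ∈ A, d x a < ε}

/-- The supremum distance on `X ^ n` (it is `0` when `n = 0`). -/
noncomputable def supDist {X : Type*} (d : X → X → ℝ) (n : ℕ) (x y : Fin n → X) : ℝ :=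
  ⨆ i, d (x i) (y i)

/-- The action of `Γ` on `(X, τ, d)` has ample generics: for all `n` and `ε > 0` there is an
`n`-tuple `x` such that `(Γ • x)_ε` is co-meagre in `X ^ n`, for the diagonal action, the product
topology and the supremum distance. -/
def ActionHasAmpleGenerics (Γ : Type*) {X : Type*} [Group Γ] [TopologicalSpace X] [MulAction Γ X]
    (d : X → X → ℝ) : Prop :=
  ∀ (n : ℕ) (ε : ℝ), 0 < ε →
    ∃ x : Fin n → X, dThickening (supDist d n) ε (MulAction.orbit Γ x) ∈ residual (Fin n → X)

/-- `(G, τ, d)` has ample generics: its action on itself by conjugation has ample generics. -/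
def HasAmpleGenerics {G : Type*} [Group G] [TopologicalSpace G] (d : G → G → ℝ) : Prop :=
  ActionHasAmpleGenerics (ConjAct G) d

/-- `A` is `σ`-syndetic: countably many left translates of `A` cover `G`. -/
def IsSigmaSyndetic {G : Type*} [Group G] (A : Set G) : Prop :=
  ∃ T : Set G, T.Countable ∧ ⋃ t ∈ T, t • A = Set.univ

/-- `(G, τ, d)` is Steinhaus with exponent `k`; here `A ^ k` is the set of all products of `k`
elements of `A`, and the interior is with respect to `τ`. -/
def IsSteinhausWithExponent {G : Type*} [Group G] [TopologicalSpace G] (d : G → G → ℝ) (k : ℕ) :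
    Prop :=
  ∀ A : Set G, A⁻¹ = A → IsSigmaSyndetic A →
    ∀ ε : ℝ, 0 < ε → (1 : G) ∈ interior (dThickening d ε (A ^ k))

/-! A σ-syndetic `A` is non-meagre, hence locally non-meagre throughout a nonempty open `U`. For `g`
near 1, `U ∩ gU` is nonempty, and on it both `A` and `gA` are locally non-meagre. By the Effros-type
theorem `exists_isOpen_subset_conjThickening`, nearby generic tuples are almost conjugate by an
element near 1. From this `exists_conj_cantor` grows a binary tree of convergent products: each node
chooses `a ∈ A` or `b ∈ gA`, and later factors barely disturb the chosen conjugate. If branches `α`,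
`β` split at that node, the limits conjugate `a` and `b` to within `ε`. There are uncountably many
branches but countably many translates, so `H α = tp` and `H β = tq` for some `α ≠ β` and `p, q ∈
A`. Writing `b = gw` and cancelling `t`, bi-invariance puts `g` within `ε` of `q⁻¹pap⁻¹qw⁻¹`, a
product of six elements of `A`, which is padded to ten. -/

open Set Topology MeasureTheory Filter

/-! ### Baire category: local non-meagreness, analytic sets, Kuratowski-Ulam -/

section Category

variable {X : Type*} [TopologicalSpace X]

/-- The set of points at which `E` is locally non-meagre. -/
def nonmeagreLocus (E : Set X) : Set X :=
  {x | ∀ V, IsOpen V → x ∈ V → ¬ IsMeagre (E ∩ V)}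

theorem isClosed_nonmeagreLocus (E : Set X) : IsClosed (nonmeagreLocus E) := by
  refine isOpen_compl_iff.1 (isOpen_iff_forall_mem_open.2 fun x hx => ?_)
  simp only [nonmeagreLocus, mem_compl_iff, mem_ofPred_eq, not_forall, not_not] at hx
  obtain ⟨V, hV, hxV, hm⟩ := hx
  exact ⟨V, fun y hy h => h V hV hy hm, hV, hxV⟩

theorem nonmeagreLocus_subset_closure (E : Set X) : nonmeagreLocus E ⊆ closure E := by
  intro x hx
  rw [mem_closure_iff]
  intro V hV hxV
  rw [inter_comm]
  exact nonempty_of_not_isMeagre (hx V hV hxV)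

theorem isMeagre_diff_nonmeagreLocus [SecondCountableTopology X] (E : Set X) :
    IsMeagre (E \ nonmeagreLocus E) := by
  let B := TopologicalSpace.countableBasis X
  have hB := TopologicalSpace.isBasis_countableBasis X
  have hc : {V ∈ B | IsMeagre (E ∩ V)}.Countable :=
    (TopologicalSpace.countable_countableBasis X).mono (sep_subset _ _)
  refine (isMeagre_biUnion (f := fun V => E ∩ V) hc fun V hV => hV.2).mono ?_
  rintro x ⟨hxE, hx⟩
  simp only [nonmeagreLocus, mem_ofPred_eq, not_forall, not_not] at hx
  obtain ⟨V, hV, hxV, hm⟩ := hx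
  obtain ⟨W, hWB, hxW, hWV⟩ := hB.exists_subset_of_mem_open hxV hV
  exact mem_biUnion (show W ∈ {V ∈ B | IsMeagre (E ∩ V)} from
    ⟨hWB, hm.mono (inter_subset_inter_right _ hWV)⟩) ⟨hxE, hxW⟩

theorem nonempty_interior_nonmeagreLocus [SecondCountableTopology X] {E : Set X}
    (hE : ¬ IsMeagre E) : (interior (nonmeagreLocus E)).Nonempty := by
  by_contra h
  refine hE (((isMeagre_diff_nonmeagreLocus E).union (IsNowhereDense.isMeagre
    ((isClosed_nonmeagreLocus E).isNowhereDense_iff.2 (not_nonempty_iff_eq_empty.1 h)))).mono ?_)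
  intro x hx
  by_cases hl : x ∈ nonmeagreLocus E
  exacts [Or.inr hl, Or.inl ⟨hx, hl⟩]

/-- Removing only the interiors of the loci leaves a closed set. On its interior, `E` is covered by
the meagre sets `F i \ nonmeagreLocus (F i)` and the frontiers of the loci, so that interior is
empty. -/
theorem isMeagre_nonmeagreLocus_diff_iUnion [SecondCountableTopology X] {ι : Type*} [Countable ι]
    {E : Set X} {F : ι → Set X} (h : E ⊆ ⋃ i, F i) :
    IsMeagre (nonmeagreLocus E \ ⋃ i, nonmeagreLocus (F i)) := by
  have hcl : IsClosed (nonmeagreLocus E \ ⋃ i, interior (nonmeagreLocus (F i))) :=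
    (isClosed_nonmeagreLocus E).inter (isOpen_iUnion fun _ => isOpen_interior).isClosed_compl
  refine IsMeagre.mono (sdiff_subset_sdiff_right (iUnion_mono fun i => interior_subset))
    (IsNowhereDense.isMeagre (hcl.isNowhereDense_iff.2 ?_))
  by_contra hne
  obtain ⟨x, hx⟩ := nonempty_iff_ne_empty.2 hne
  refine (interior_subset hx).1 _ isOpen_interior hx ?_
  have hm : ∀ i, IsMeagre (F i \ nonmeagreLocus (F i) ∪ frontier (nonmeagreLocus (F i))) :=
    fun i => (isMeagre_diff_nonmeagreLocus _).union (IsNowhereDense.isMeagre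
      (isClosed_frontier.isNowhereDense_iff.2 (interior_frontier (isClosed_nonmeagreLocus _))))
  refine (isMeagre_iUnion hm).mono ?_
  rintro y ⟨hyE, hy⟩
  obtain ⟨i, hi⟩ := mem_iUnion.1 (h hyE)
  refine mem_iUnion.2 ⟨i, ?_⟩
  by_cases hl : y ∈ nonmeagreLocus (F i)
  · refine Or.inr ?_
    rw [(isClosed_nonmeagreLocus _).frontier_eq]
    exact ⟨hl, fun hyi => (interior_subset hy).2 (mem_iUnion.2 ⟨i, hyi⟩)⟩
  · exact Or.inl ⟨hi, hl⟩

/-- An analytic set contains almost every point at which it is locally non-meagre. -/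
theorem MeasureTheory.AnalyticSet.isMeagre_nonmeagreLocus_diff [SecondCountableTopology X]
    [T2Space X] {E : Set X} (hE : AnalyticSet E) : IsMeagre (nonmeagreLocus E \ E) := by
  rw [AnalyticSet] at hE
  rcases hE with rfl | ⟨f, hf, rfl⟩
  · refine IsMeagre.empty.mono ?_
    rintro x ⟨hx, -⟩
    exact absurd (IsMeagre.empty.mono (empty_inter _).subset) (hx univ isOpen_univ trivial)
  -- `PiNat.res` lists the latest coordinate first, so consing refines a cylinder.
  let C : List ℕ → Set X := fun s => f '' {a | PiNat.res a s.length = s}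
  have hC : ∀ s, C s ⊆ ⋃ k, C (k :: s) := by
    rintro s _ ⟨a, ha, rfl⟩
    exact mem_iUnion.2 ⟨a s.length, a, congrArg (a s.length :: ·) ha, rfl⟩
  have hm := isMeagre_iUnion fun s => isMeagre_nonmeagreLocus_diff_iUnion (hC s)
  refine hm.mono ?_
  rintro x ⟨hx, hxE⟩
  by_contra hnot
  -- Off the exceptional meagre sets, one can follow a branch `a` whose cylinders all have images
  -- non-meagre at `x`; continuity of `f` then forces `x = f a`.
  have hstep : ∀ s, x ∈ nonmeagreLocus (C s) → ∃ k, x ∈ nonmeagreLocus (C (k :: s)) := by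
    intro s hs
    by_contra hk
    exact hnot (mem_iUnion.2 ⟨s, hs, fun h => hk (mem_iUnion.1 h)⟩)
  choose! k hk using hstep
  let S : ℕ → List ℕ := fun n => Nat.rec [] (fun _ s => k s :: s) n
  have hS : ∀ n, S (n + 1) = k (S n) :: S n := fun n => rfl
  have hlen : ∀ n, (S n).length = n := by
    intro n
    induction n with
    | zero => rfl
    | succ n ih => simp [hS, ih]
  have hmem : ∀ n, x ∈ nonmeagreLocus (C (S n)) := by
    intro n
    induction n with
    | zero =>
      have : C (S 0) = range f := by simp [C, S]
      rw [this]
      exact hx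
    | succ n ih => exact hk _ ih
  let a : ℕ → ℕ := fun n => k (S n)
  have hpre : ∀ n, S n = PiNat.res a n := by
    intro n
    induction n with
    | zero => rfl
    | succ n ih => rw [hS, PiNat.res_succ, ← ih]
  have hxa : x ≠ f a := fun h => hxE ⟨a, h.symm⟩
  obtain ⟨U, V, hU, hV, hxU, haV, hUV⟩ := t2_separation hxa
  obtain ⟨n, hn⟩ : ∃ n, PiNat.cylinder a n ⊆ f ⁻¹' V := by
    obtain ⟨v, ⟨b, n, rfl⟩, hav, hvV⟩ :=
      (PiNat.isTopologicalBasis_cylinders (fun _ : ℕ => ℕ)).exists_subset_of_mem_open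
        (show a ∈ f ⁻¹' V from haV) (hV.preimage hf)
    exact ⟨n, by rwa [PiNat.mem_cylinder_iff_eq.1 hav]⟩
  have hCV : C (S n) ⊆ V := by
    rintro _ ⟨b, hb, rfl⟩
    rw [mem_ofPred_eq, hlen, hpre] at hb
    exact hn (PiNat.cylinder_eq_res a n ▸ hb)
  obtain ⟨z, hzU, hzC⟩ := mem_closure_iff.1 (nonmeagreLocus_subset_closure _ (hmem n)) U hU hxU
  exact disjoint_left.1 hUV hzU (hCV hzC)

theorem MeasureTheory.AnalyticSet.exists_isOpen_isMeagre_diff [SecondCountableTopology X]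
    [T2Space X] {E : Set X} (hE : AnalyticSet E) (h : ¬ IsMeagre E) :
    ∃ W, IsOpen W ∧ W.Nonempty ∧ IsMeagre (W \ E) :=
  ⟨_, isOpen_interior, nonempty_interior_nonmeagreLocus h,
    hE.isMeagre_nonmeagreLocus_diff.mono (sdiff_subset_sdiff_left interior_subset)⟩

/-- The easy half of the Kuratowski-Ulam theorem. -/
theorem eventually_residual_eventually_residual {Y : Type*} [TopologicalSpace Y]
    [SecondCountableTopology Y] {C : Set (X × Y)} (hC : C ∈ residual (X × Y)) :
    ∀ᶠ x in residual X, ∀ᶠ y in residual Y, (x, y) ∈ C := by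
  obtain ⟨S, hSo, hSd, hSc, hSC⟩ := mem_residual_iff.1 hC
  have key : ∀ U ∈ S, ∀ᶠ x in residual X, ∀ᶠ y in residual Y, (x, y) ∈ U := by
    intro U hU
    let B := TopologicalSpace.countableBasis Y
    have hB := TopologicalSpace.isBasis_countableBasis Y
    have h1 : ∀ V ∈ B, ∀ᶠ x in residual X, ∃ y ∈ V, (x, y) ∈ U := by
      intro V hV
      have heq : {x | ∃ y ∈ V, (x, y) ∈ U} = Prod.fst '' (U ∩ Prod.snd ⁻¹' V) := by
        ext x
        constructor
        · rintro ⟨y, hy, hxy⟩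
          exact ⟨(x, y), ⟨hxy, hy⟩, rfl⟩
        · rintro ⟨⟨x, y⟩, ⟨hxy, hy⟩, rfl⟩
          exact ⟨y, hy, hxy⟩
      refine residual_of_dense_open ?_ ?_
      · rw [heq]
        exact isOpenMap_fst _ ((hSo U hU).inter ((hB.isOpen hV).preimage continuous_snd))
      · refine dense_iff_inter_open.2 fun W hW hWne => ?_
        obtain ⟨⟨x, y⟩, ⟨hx, hy⟩, hxy⟩ := dense_iff_inter_open.1 (hSd U hU) (W ×ˢ V)
          (hW.prod (hB.isOpen hV))
          (hWne.prod (TopologicalSpace.nonempty_of_mem_countableBasis hV))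
        exact ⟨x, hx, y, hy, hxy⟩
    have h2 := (eventually_countable_ball (TopologicalSpace.countable_countableBasis Y)).2 h1
    filter_upwards [h2] with x hx
    refine residual_of_dense_open ((hSo U hU).preimage (by fun_prop)) ?_
    refine hB.dense_iff.2 fun V hV _ => ?_
    obtain ⟨y, hy, hxy⟩ := hx V hV
    exact ⟨y, hy, hxy⟩
  filter_upwards [(eventually_countable_ball hSc).2 key] with x hx
  filter_upwards [(eventually_countable_ball hSc).2 hx] with y hy
  exact hSC fun U hU => hy U hU

/-- Currying `(X ^ (n + 1))` as `X ^ n × X`, splitting off the last coordinate. -/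
def Homeomorph.finSnoc (n : ℕ) : (Fin n → X) × X ≃ₜ (Fin (n + 1) → X) where
  toFun p := Fin.snoc p.1 p.2
  invFun x := (Fin.init x, x (Fin.last n))
  left_inv p := by simp
  right_inv x := by simp
  continuous_toFun := by fun_prop
  continuous_invFun := by unfold Fin.init; fun_prop

theorem eventually_residual_snoc [SecondCountableTopology X] {n : ℕ} {C : Set (Fin (n + 1) → X)}
    (hC : C ∈ residual (Fin (n + 1) → X)) :
    ∀ᶠ x in residual (Fin n → X), ∀ᶠ y in residual X, (Fin.snoc x y : Fin (n + 1) → X) ∈ C := by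
  rw [← (Homeomorph.finSnoc (X := X) n).residual_map_eq] at hC
  exact eventually_residual_eventually_residual hC

/-- A comeagre sequence of subsets of the finite powers of `X` contains a sequence of comeagre sets
each of whose members extends to a member of the next set by almost every point. -/
theorem exists_hereditarily_residual [SecondCountableTopology X] (O : ∀ n : ℕ, Set (Fin n → X))
    (hO : ∀ n, O n ∈ residual (Fin n → X)) :
    ∃ P : ∀ n : ℕ, Set (Fin n → X), (∀ n, P n ⊆ O n) ∧ (∀ n, P n ∈ residual (Fin n → X)) ∧
      ∀ n, ∀ x ∈ P n, ∀ᶠ y in residual X, (Fin.snoc x y : Fin (n + 1) → X) ∈ P (n + 1) := by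
  let Q : ℕ → ∀ n : ℕ, Set (Fin n → X) := fun m => Nat.rec O
    (fun _ R n => {x | ∀ᶠ y in residual X, (Fin.snoc x y : Fin (n + 1) → X) ∈ R (n + 1)}) m
  have hQ : ∀ m n, Q m n ∈ residual (Fin n → X) := by
    intro m
    induction m with
    | zero => exact hO
    | succ m ih => exact fun n => eventually_residual_snoc (ih (n + 1))
  -- `Q m` asks for `m` successive generic extensions ending in `O`; intersecting over all `m` makes
  -- the condition reproduce itself.
  refine ⟨fun n => ⋂ m, Q m n, fun n => iInter_subset (fun m => Q m n) 0,
    fun n => countable_iInter_mem.2 fun m => hQ m n, fun n x hx => ?_⟩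
  have : ∀ m, ∀ᶠ y in residual X, (Fin.snoc x y : Fin (n + 1) → X) ∈ Q m (n + 1) :=
    fun m => mem_iInter.1 hx (m + 1)
  filter_upwards [eventually_countable_forall.2 this] with y hy
  exact mem_iInter.2 hy

end Category

/-! ### Topometric preliminaries -/

theorem supDist_lt_iff {X : Type*} {d : X → X → ℝ} {n : ℕ} {ε : ℝ} (hε : 0 < ε)
    {x y : Fin n → X} : supDist d n x y < ε ↔ ∀ i, d (x i) (y i) < ε := by
  rcases isEmpty_or_nonempty (Fin n) with h | h
  · simp [supDist, Real.iSup_of_isEmpty, hε]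
  · exact ⟨fun hlt i => (le_ciSup (finite_range _).bddAbove i).trans_lt hlt,
      fun hlt => by
        obtain ⟨i, hi⟩ := exists_eq_ciSup_of_finite (f := fun i => d (x i) (y i))
        exact (show supDist d n x y = _ from hi.symm) ▸ hlt i⟩

section Topometric

variable {X : Type*} [TopologicalSpace X] {d : X → X → ℝ}

theorem IsTopometricSpace.self (hd : IsTopometricSpace d) (x : X) : d x x = 0 :=
  (hd.eq_zero_iff x x).2 rfl

theorem IsTopometricSpace.measurable_uncurry [MeasurableSpace X] [BorelSpace X]
    [SecondCountableTopology X] (hd : IsTopometricSpace d) :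
    Measurable fun p : X × X => d p.1 p.2 :=
  measurable_of_Iic fun r => (hd.isClosed_le r).measurableSet

end Topometric

/-! ### Almost conjugacy and metrically generic tuples -/

section Group

variable {G : Type*} [Group G]

/-- The tuples at uniform distance less than `ε` from a conjugate of `y` by an element of `N`. -/
def conjThickening (d : G → G → ℝ) {n : ℕ} (N : Set G) (y : Fin n → G) (ε : ℝ) :
    Set (Fin n → G) :=
  {x | ∃ h ∈ N, ∀ i, d (x i) (h * y i * h⁻¹) < ε}

theorem conjThickening_mono {d : G → G → ℝ} {n : ℕ} {M N : Set G} {y : Fin n → G} {δ ε : ℝ}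
    (hMN : M ⊆ N) (hδε : δ ≤ ε) : conjThickening d M y δ ⊆ conjThickening d N y ε :=
  fun _ ⟨h, hh, hx⟩ => ⟨h, hMN hh, fun i => (hx i).trans_le hδε⟩

theorem dThickening_orbit_conjAct (d : G → G → ℝ) {n : ℕ} {ε : ℝ} (hε : 0 < ε) (y : Fin n → G) :
    dThickening (supDist d n) ε (MulAction.orbit (ConjAct G) y) = conjThickening d univ y ε := by
  ext x
  constructor
  · rintro ⟨_, ⟨h, rfl⟩, hx⟩
    exact ⟨ConjAct.ofConjAct h, trivial, (supDist_lt_iff hε).1 hx⟩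
  · rintro ⟨h, -, hx⟩
    exact ⟨_, ⟨ConjAct.toConjAct h, rfl⟩, (supDist_lt_iff hε).2 hx⟩

variable [TopologicalSpace G] {d : G → G → ℝ}

theorem IsTopometricGroup.conj (hG : IsTopometricGroup d) (g x y : G) :
    d (g * x * g⁻¹) (g * y * g⁻¹) = d x y := by
  rw [hG.mul_right_invariant, hG.mul_left_invariant]

theorem IsTopometricGroup.conj_inv (hG : IsTopometricGroup d) (g x y : G) :
    d (g⁻¹ * x * g) y = d x (g * y * g⁻¹) := by
  rw [← hG.conj g (g⁻¹ * x * g) y]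
  congr 1
  group

theorem IsTopometricGroup.conjThickening_symm (hG : IsTopometricGroup d) {n : ℕ} {N : Set G}
    {x y : Fin n → G} {ε : ℝ} (h : x ∈ conjThickening d N y ε) :
    y ∈ conjThickening d N⁻¹ x ε := by
  obtain ⟨k, hk, hx⟩ := h
  refine ⟨k⁻¹, Set.inv_mem_inv.2 hk, fun i => ?_⟩
  rw [inv_inv, hG.symm, hG.conj_inv]
  exact hx i

theorem IsTopometricGroup.conjThickening_trans (hG : IsTopometricGroup d) {n : ℕ} {M N : Set G}
    {x y z : Fin n → G} {δ ε : ℝ} (hx : x ∈ conjThickening d M y δ)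
    (hy : y ∈ conjThickening d N z ε) : x ∈ conjThickening d (M * N) z (δ + ε) := by
  obtain ⟨h, hh, hx⟩ := hx
  obtain ⟨k, hk, hy⟩ := hy
  refine ⟨h * k, Set.mul_mem_mul hh hk, fun i => ?_⟩
  have h1 := hG.triangle (x i) (h * y i * h⁻¹) (h * k * z i * (h * k)⁻¹)
  have h2 := hG.conj h (y i) (k * z i * k⁻¹)
  have h3 : h * (k * z i * k⁻¹) * h⁻¹ = h * k * z i * (h * k)⁻¹ := by group
  rw [h3] at h2
  linarith [hx i, hy i]

/-- A tuple is metrically generic if all thickenings of its conjugacy class are comeagre. -/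
def IsMetricallyGeneric (d : G → G → ℝ) {n : ℕ} (y : Fin n → G) : Prop :=
  ∀ ε : ℝ, 0 < ε → conjThickening d univ y ε ∈ residual (Fin n → G)

/-- Ample generics gives a witness for each `1 / (k + 1)`; a tuple almost conjugate to all of these
witnesses is generic at every scale. -/
theorem IsTopometricGroup.residual_isMetricallyGeneric (hG : IsTopometricGroup d)
    (hample : HasAmpleGenerics d) (n : ℕ) :
    {y : Fin n → G | IsMetricallyGeneric d y} ∈ residual (Fin n → G) := by
  have h1 : ∀ k : ℕ, ∃ y : Fin n → G,
      conjThickening d univ y (1 / (k + 1 : ℝ)) ∈ residual (Fin n → G) := by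
    intro k
    have hk : (0 : ℝ) < 1 / (k + 1 : ℝ) := by positivity
    obtain ⟨y, hy⟩ := hample n _ hk
    exact ⟨y, by rwa [← dThickening_orbit_conjAct d hk]⟩
  choose y hy using h1
  filter_upwards [countable_iInter_mem.2 hy] with z hz ε hε
  obtain ⟨k, hk⟩ := exists_nat_one_div_lt (half_pos hε)
  filter_upwards [hy k] with x hx
  exact conjThickening_mono (subset_univ _) (by linarith)
    (hG.conjThickening_trans hx (hG.conjThickening_symm (mem_iInter.1 hz k)))

/-- This is a projection of a Borel set, since lower semi-continuity makes `d` Borel. -/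
theorem IsTopometricGroup.analyticSet_conjThickening [PolishSpace G] (hG : IsTopometricGroup d)
    {n : ℕ} {N : Set G} (hN : IsOpen N) (y : Fin n → G) (ε : ℝ) :
    AnalyticSet (conjThickening d N y ε) := by
  have := hG.toIsTopologicalGroup
  borelize G
  have heq : conjThickening d N y ε = Prod.fst ''
      (Prod.snd ⁻¹' N ∩ ⋂ i, {p : (Fin n → G) × G | d (p.1 i) (p.2 * y i * p.2⁻¹) < ε}) := by
    ext x
    simp [conjThickening]
  rw [heq]
  refine MeasurableSet.analyticSet_image (MeasurableSet.inter (measurable_snd hN.measurableSet)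
    (MeasurableSet.iInter fun i => ?_)) measurable_fst
  have hc : Continuous fun p : (Fin n → G) × G => (p.1 i, p.2 * y i * p.2⁻¹) := by fun_prop
  exact measurableSet_lt (hG.measurable_uncurry.comp hc.measurable) measurable_const

theorem IsMeagre.preimage_homeomorph {X Y : Type*} [TopologicalSpace X] [TopologicalSpace Y]
    (e : X ≃ₜ Y) {s : Set Y} (hs : IsMeagre s) : IsMeagre (e ⁻¹' s) :=
  hs.preimage_of_isOpenMap e.continuous e.isOpenMap

/-- Conjugates of this set by a countable dense set cover the comeagre thickening of the whole
class. -/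
theorem IsMetricallyGeneric.not_isMeagre_conjThickening [PolishSpace G]
    (hG : IsTopometricGroup d) {n : ℕ} {y : Fin n → G} (hy : IsMetricallyGeneric d y) {N : Set G}
    (hN : N ∈ 𝓝 1) {ε : ℝ} (hε : 0 < ε) : ¬ IsMeagre (conjThickening d N y ε) := by
  have := hG.toIsTopologicalGroup
  intro hm
  refine not_isMeagre_of_mem_residual (hy ε hε) ?_
  obtain ⟨D, hDc, hD⟩ := TopologicalSpace.exists_countable_dense G
  let e : G → (Fin n → G) ≃ₜ (Fin n → G) := fun t =>
    Homeomorph.piCongrRight fun _ => (Homeomorph.mulLeft t⁻¹).trans (Homeomorph.mulRight t)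
  refine (isMeagre_biUnion hDc fun t _ => hm.preimage_homeomorph (e t)).mono ?_
  rintro x ⟨h, -, hx⟩
  have hmem : {t : G | t⁻¹ * h ∈ interior N} ∈ 𝓝 h := by
    refine (isOpen_interior.preimage (by fun_prop)).mem_nhds ?_
    simpa [mem_interior_iff_mem_nhds] using hN
  obtain ⟨t, htN, htD⟩ := mem_closure_iff_nhds.1 (hD h) _ hmem
  refine mem_biUnion htD ⟨t⁻¹ * h, interior_subset htN, fun i => ?_⟩
  have h1 : t⁻¹ * h * y i * (t⁻¹ * h)⁻¹ = t⁻¹ * (h * y i * h⁻¹) * t := by group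
  have h2 : e t x i = t⁻¹ * x i * t := rfl
  rw [h1, h2, hG.mul_right_invariant, hG.mul_left_invariant]
  exact hx i

theorem exists_inv_mul_subset [IsTopologicalGroup G] {N : Set G} (hN : N ∈ 𝓝 1) :
    ∃ M : Set G, IsOpen M ∧ (1 : G) ∈ M ∧ M⁻¹ * M ⊆ N := by
  have hc : Continuous fun p : G × G => p.1⁻¹ * p.2 := by fun_prop
  have h1 : (fun p : G × G => p.1⁻¹ * p.2) ⁻¹' N ∈ 𝓝 ((1 : G), (1 : G)) :=
    hc.continuousAt.preimage_mem_nhds (by simpa using hN)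
  obtain ⟨U, hU, V, hV, hUV⟩ := mem_nhds_prod_iff.1 h1
  refine ⟨interior (U ∩ V), isOpen_interior,
    mem_interior_iff_mem_nhds.2 (Filter.inter_mem hU hV), ?_⟩
  rintro _ ⟨a, ha, b, hb, rfl⟩
  have h2 := @hUV (a⁻¹, b) ⟨(interior_subset (Set.mem_inv.1 ha)).1, (interior_subset hb).2⟩
  simpa using h2

theorem IsMetricallyGeneric.exists_isMeagre_diff [PolishSpace G] (hG : IsTopometricGroup d)
    {n : ℕ} {y : Fin n → G} (hy : IsMetricallyGeneric d y) {N : Set G} (hN : N ∈ 𝓝 1) {ε : ℝ}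
    (hε : 0 < ε) : ∃ V, IsOpen V ∧ y ∈ V ∧ IsMeagre (V \ conjThickening d N y ε) := by
  have := hG.toIsTopologicalGroup
  obtain ⟨M, hMo, hM1, hMN⟩ := exists_inv_mul_subset hN
  obtain ⟨W, hWo, hWne, hW⟩ := (hG.analyticSet_conjThickening hMo y (ε / 2)
    ).exists_isOpen_isMeagre_diff
      (hy.not_isMeagre_conjThickening hG (hMo.mem_nhds hM1) (half_pos hε))
  obtain ⟨z, hzW, h, hh, hz⟩ : (W ∩ conjThickening d M y (ε / 2)).Nonempty := by
    by_contra hne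
    refine not_isMeagre_of_isOpen hWo hWne (hW.mono ?_)
    exact fun z hz => ⟨hz, fun hz' => hne ⟨z, hz, hz'⟩⟩
  -- Right translation by `c`, followed by conjugation by `h`, sends `y` to `z`. By bi-invariance,
  -- translation by `c i` moves every point by the same distance, less than `ε / 2`.
  let c : Fin n → G := fun i => (y i)⁻¹ * (h⁻¹ * z i * h)
  let e : (Fin n → G) ≃ₜ (Fin n → G) := Homeomorph.piCongrRight fun i =>
    (Homeomorph.mulLeft h).trans (Homeomorph.mulRight (c i * h⁻¹))
  have he : ∀ x i, e x i = h * x i * (c i * h⁻¹) := fun x i => rfl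
  refine ⟨e ⁻¹' W, hWo.preimage e.continuous, ?_, (hW.preimage_homeomorph e).mono ?_⟩
  · have : e y = z := funext fun i => by rw [he]; simp only [c]; group
    rwa [mem_preimage, this]
  · rintro x ⟨hxW, hx⟩
    refine ⟨hxW, fun ⟨k, hk, hkx⟩ => hx ?_⟩
    refine ⟨h⁻¹ * k, hMN (Set.mul_mem_mul (Set.inv_mem_inv.2 hh) hk), fun i => ?_⟩
    have h1 := hG.triangle (x i) (x i * c i) (h⁻¹ * k * y i * (h⁻¹ * k)⁻¹)
    have h2 : d (x i) (x i * c i) < ε / 2 := by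
      have e1 := hG.mul_left_invariant (y i * (x i)⁻¹) (x i) (x i * c i)
      have e2 : y i * (x i)⁻¹ * x i = y i := by group
      have e3 : y i * (x i)⁻¹ * (x i * c i) = h⁻¹ * z i * h := by simp only [c]; group
      rw [e2, e3, hG.symm, hG.conj_inv] at e1
      exact e1 ▸ hz i
    have h3 : d (x i * c i) (h⁻¹ * k * y i * (h⁻¹ * k)⁻¹) < ε / 2 := by
      rw [← hG.conj h]
      have e1 : h * (x i * c i) * h⁻¹ = e x i := by rw [he]; group
      have e2 : h * (h⁻¹ * k * y i * (h⁻¹ * k)⁻¹) * h⁻¹ = k * y i * k⁻¹ := by group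
      rw [e1, e2]
      exact hkx i
    linarith

/-- An Effros-type theorem for metrically generic tuples. -/
theorem IsMetricallyGeneric.exists_isOpen_subset_conjThickening [PolishSpace G]
    (hG : IsTopometricGroup d) {n : ℕ} {y : Fin n → G} (hy : IsMetricallyGeneric d y) {N : Set G}
    (hN : N ∈ 𝓝 1) {ε : ℝ} (hε : 0 < ε) :
    ∃ V, IsOpen V ∧ y ∈ V ∧ ∀ x ∈ V, IsMetricallyGeneric d x → x ∈ conjThickening d N y ε := by
  have := hG.toIsTopologicalGroup
  obtain ⟨M, hMo, hM1, hMN⟩ := exists_inv_mul_subset hN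
  have hM := hMo.mem_nhds hM1
  obtain ⟨V, hVo, hyV, hV⟩ := hy.exists_isMeagre_diff hG hM (half_pos hε)
  refine ⟨V, hVo, hyV, fun x hxV hx => ?_⟩
  obtain ⟨U, hUo, hxU, hU⟩ := hx.exists_isMeagre_diff hG hM (half_pos hε)
  obtain ⟨z, hzx, hzy⟩ : (conjThickening d M x (ε / 2) ∩ conjThickening d M y (ε / 2)).Nonempty := by
    by_contra hne
    refine not_isMeagre_of_isOpen (hUo.inter hVo) ⟨x, hxU, hxV⟩ ((hU.union hV).mono ?_)
    rintro z ⟨hzU, hzV⟩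
    by_cases hz : z ∈ conjThickening d M x (ε / 2)
    exacts [Or.inr ⟨hzV, fun hz' => hne ⟨z, hz, hz'⟩⟩, Or.inl ⟨hzU, hz⟩]
  exact conjThickening_mono hMN (by linarith)
    (hG.conjThickening_trans (hG.conjThickening_symm hzx) hzy)

end Group

/-! ### The Cantor scheme of conjugations -/

section Steinhaus

theorem exists_mem_of_subset_nonmeagreLocus {X : Type*} [TopologicalSpace X] {A W : Set X}
    (hW : IsOpen W) (hWne : W.Nonempty) (hWA : W ⊆ nonmeagreLocus A) {p : X → Prop}
    (hp : ∀ᶠ x in residual X, p x) : ∃ x ∈ A, x ∈ W ∧ p x := by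
  by_contra! hne
  obtain ⟨w, hw⟩ := hWne
  refine hWA hw W hW hw ?_
  refine IsMeagre.mono (s := {x | p x}ᶜ) (fun x hx => hne x hx.1 hx.2) ?_
  rw [IsMeagre, compl_compl]
  exact hp

variable {G : Type*} [Group G] [TopologicalSpace G] {d : G → G → ℝ}

theorem smul_subset_nonmeagreLocus_smul [IsTopologicalGroup G] (g : G) {A U : Set G}
    (hU : U ⊆ nonmeagreLocus A) : g • U ⊆ nonmeagreLocus (g • A) := by
  rintro _ ⟨u, hu, rfl⟩ V hV huV hm
  refine hU hu _ (hV.preimage (Homeomorph.mulLeft g).continuous) huV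
    ((hm.preimage_homeomorph (Homeomorph.mulLeft g)).mono ?_)
  rintro x ⟨hxA, hxV⟩
  exact ⟨Set.smul_mem_smul_set hxA, hxV⟩

theorem IsSigmaSyndetic.not_isMeagre [IsTopologicalGroup G] [BaireSpace G] {A : Set G}
    (hA : IsSigmaSyndetic A) : ¬ IsMeagre A := by
  obtain ⟨T, hT, hTA⟩ := hA
  intro hm
  refine not_isMeagre_of_isOpen (isOpen_univ (X := G)) univ_nonempty ?_
  rw [← hTA]
  refine isMeagre_biUnion hT fun t _ =>
    (hm.preimage_homeomorph (Homeomorph.mulLeft t⁻¹)).mono ?_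
  rintro _ ⟨a, ha, rfl⟩
  simpa using ha

/-- The Effros-type theorem is applied at the generic tuple `(x, a)`, with `b` chosen close to `a`:
one `f` almost fixes `x` and almost carries `b` to `a`. -/
theorem IsTopometricGroup.exists_extensions [PolishSpace G] (hG : IsTopometricGroup d)
    {P : ∀ n : ℕ, Set (Fin n → G)} (hPg : ∀ n, ∀ x ∈ P n, IsMetricallyGeneric d x)
    (hP : ∀ n, ∀ x ∈ P n, ∀ᶠ y in residual G, (Fin.snoc x y : Fin (n + 1) → G) ∈ P (n + 1))
    {A B W : Set G} (hW : IsOpen W) (hWne : W.Nonempty) (hWA : W ⊆ nonmeagreLocus A)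
    (hWB : W ⊆ nonmeagreLocus B) {n : ℕ} {x : Fin n → G} (hx : x ∈ P n) {N : Set G}
    (hN : N ∈ 𝓝 1) {ε : ℝ} (hε : 0 < ε) :
    ∃ a ∈ A, ∃ b ∈ B, ∃ f ∈ N, (Fin.snoc x a : Fin (n + 1) → G) ∈ P (n + 1) ∧
      (Fin.snoc x b : Fin (n + 1) → G) ∈ P (n + 1) ∧ (∀ i, d (f * x i * f⁻¹) (x i) < ε) ∧
      d (f * b * f⁻¹) a < ε := by
  have := hG.toIsTopologicalGroup
  obtain ⟨a, haA, haW, haP⟩ := exists_mem_of_subset_nonmeagreLocus hW hWne hWA (hP n x hx)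
  obtain ⟨V, hV, haV, hVP⟩ := (hPg _ _ haP).exists_isOpen_subset_conjThickening hG
    (inv_mem_nhds_one G hN) hε
  have hc : Continuous fun y : G => (Fin.snoc x y : Fin (n + 1) → G) := by fun_prop
  obtain ⟨b, hbB, hbW, hbP⟩ := exists_mem_of_subset_nonmeagreLocus (hW.inter (hV.preimage hc))
    ⟨a, haW, haV⟩ (inter_subset_left.trans hWB) (hP n x hx)
  obtain ⟨k, hk, hkd⟩ := hVP _ hbW.2 (hPg _ _ hbP)
  refine ⟨a, haA, b, hbB, k⁻¹, hk, haP, hbP, fun i => ?_, ?_⟩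
  · rw [inv_inv, hG.conj_inv]
    simpa using hkd i.castSucc
  · rw [inv_inv, hG.conj_inv]
    simpa using hkd (Fin.last n)

/-- If `A` and `B` are locally non-meagre throughout a nonempty open set, then there is a family of
conjugations, indexed by the Cantor space, any two of which bring `A` and `B` close together. -/
theorem IsTopometricGroup.exists_conj_cantor [PolishSpace G] (hG : IsTopometricGroup d)
    (hample : HasAmpleGenerics d) {A B W : Set G} (hW : IsOpen W) (hWne : W.Nonempty)
    (hWA : W ⊆ nonmeagreLocus A) (hWB : W ⊆ nonmeagreLocus B) {ε : ℝ} (hε : 0 < ε) :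
    ∃ H : (ℕ → Bool) → G, ∀ (α β : ℕ → Bool) (n : ℕ), (∀ m < n, α m = β m) → α n = false →
      β n = true → ∃ a ∈ A, ∃ b ∈ B, d (H α * a * (H α)⁻¹) (H β * b * (H β)⁻¹) < ε := by
  have := hG.toIsTopologicalGroup
  let := TopologicalSpace.upgradeIsCompletelyMetrizable G
  obtain ⟨P, hPg, hPr, hP⟩ := exists_hereditarily_residual
    (fun n => {y : Fin n → G | IsMetricallyGeneric d y}) (hG.residual_isMetricallyGeneric hample)
  -- Two limits and one branching cost at most `η` each; the last quarter gives strictness.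
  let η : ℝ := ε / 4
  have hη : 0 < η := by positivity
  let r : ∀ n : ℕ, (ℕ → G) → Fin n → G := fun n x i => x i
  have hr : ∀ n x a, r (n + 1) (Function.update x n a) = Fin.snoc (r n x) a := by
    intro n x a
    funext i
    refine Fin.lastCases ?_ (fun j => ?_) i
    · simp [r]
    · simp [r, j.2.ne]
  have hstep : ∀ (n : ℕ) (h : G) (x : ℕ → G), r n x ∈ P n → ∃ a b f : G, a ∈ A ∧ b ∈ B ∧
      dist h (h * f) ≤ 1 * (1 / 2) ^ n ∧ Fin.snoc (r n x) a ∈ P (n + 1) ∧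
      Fin.snoc (r n x) b ∈ P (n + 1) ∧
      (∀ i < n, d (f * x i * f⁻¹) (x i) < η * (1 / 2) ^ n) ∧
      d (f * b * f⁻¹) a < η * (1 / 2) ^ n := by
    intro n h x hx
    -- The complete metric need not be invariant, so this neighbourhood depends on `h`.
    have hN : {f : G | dist h (h * f) < 1 * (1 / 2) ^ n} ∈ 𝓝 1 :=
      (isOpen_lt (by fun_prop) continuous_const).mem_nhds (by simp)
    obtain ⟨a, ha, b, hb, f, hf, h1, h2, h3, h4⟩ := hG.exists_extensions
      (fun n x hx => hPg n hx) hP hW hWne hWA hWB hx hN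
      (show 0 < η * (1 / 2) ^ n by positivity)
    exact ⟨a, b, f, ha, hb, hf.le, h1, h2, fun i hi => h3 ⟨i, hi⟩, h4⟩
  choose! a b f haA hbB hf hPa hPb hfx hfb using hstep
  -- The state is the partial product and the chosen points; entries from index `n` on are
  -- placeholders.
  let st : (ℕ → Bool) → ℕ → G × (ℕ → G) := fun α n => Nat.rec (1, fun _ => 1)
    (fun n s => if α n then (s.1 * f n s.1 s.2, Function.update s.2 n (b n s.1 s.2))
      else (s.1, Function.update s.2 n (a n s.1 s.2))) n
  have hst : ∀ α n, st α (n + 1) = if α n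
      then ((st α n).1 * f n (st α n).1 (st α n).2,
        Function.update (st α n).2 n (b n (st α n).1 (st α n).2))
      else ((st α n).1, Function.update (st α n).2 n (a n (st α n).1 (st α n).2)) :=
    fun α n => rfl
  have hmem : ∀ α n, r n (st α n).2 ∈ P n := by
    intro α n
    induction n with
    | zero =>
      obtain ⟨x, hx⟩ := (dense_of_mem_residual (hPr 0)).nonempty
      rwa [Subsingleton.elim (r 0 (st α 0).2) x]
    | succ n ih =>
      rw [hst]
      split_ifs
      · rw [hr]; exact hPb _ _ _ ih
      · rw [hr]; exact hPa _ _ _ ih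
  have hdist : ∀ α n, dist (st α n).1 (st α (n + 1)).1 ≤ 1 * (1 / 2) ^ n := by
    intro α n
    rw [hst]
    split_ifs
    · exact hf _ _ _ (hmem α n)
    · rw [dist_self]; positivity
  have hcoord : ∀ α n, ∀ i < n, (st α (n + 1)).2 i = (st α n).2 i := by
    intro α n i hi
    rw [hst]
    split_ifs <;> simp [hi.ne]
  have hconj : ∀ α n, ∀ i < n, d ((st α (n + 1)).1 * (st α n).2 i * (st α (n + 1)).1⁻¹)
      ((st α n).1 * (st α n).2 i * (st α n).1⁻¹) ≤ η * (1 / 2) ^ n := by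
    intro α n i hi
    rw [hst]
    split_ifs
    · rw [← hG.conj (st α n).1⁻¹]
      refine le_trans (le_of_eq ?_) (hfx n (st α n).1 _ (hmem α n) i hi).le
      congr 1 <;> group
    · rw [hG.self]; positivity
  have hlim : ∀ α, ∃ g, Tendsto (fun n => (st α n).1) atTop (𝓝 g) := fun α =>
    cauchySeq_tendsto_of_complete
      (cauchySeq_of_le_geometric (1 / 2) 1 (by norm_num) (hdist α))
  choose H hH using hlim
  have hbound : ∀ α i k, (st α (i + 1 + k)).2 i = (st α (i + 1)).2 i ∧
      d ((st α (i + 1 + k)).1 * (st α (i + 1)).2 i * (st α (i + 1 + k)).1⁻¹)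
        ((st α (i + 1)).1 * (st α (i + 1)).2 i * (st α (i + 1)).1⁻¹) ≤
      η * (1 - (1 / 2) ^ k) := by
    intro α i k
    induction k with
    | zero => simp [hG.self]
    | succ k ih =>
      have hlt : i < i + 1 + k := by omega
      refine ⟨(hcoord α _ i hlt).trans ih.1, (hG.triangle _
        ((st α (i + 1 + k)).1 * (st α (i + 1)).2 i * (st α (i + 1 + k)).1⁻¹) _).trans ?_⟩
      have h1 := hconj α (i + 1 + k) i hlt
      rw [ih.1] at h1
      have h2 : ((1 : ℝ) / 2) ^ (i + 1 + k) ≤ (1 / 2) ^ (k + 1) :=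
        pow_le_pow_of_le_one (by norm_num) (by norm_num) (by omega)
      have h3 := mul_le_mul_of_nonneg_left h2 hη.le
      refine (add_le_add (h1.trans h3) ih.2).trans (le_of_eq ?_)
      ring
  have hlimit : ∀ α i, d (H α * (st α (i + 1)).2 i * (H α)⁻¹)
      ((st α (i + 1)).1 * (st α (i + 1)).2 i * (st α (i + 1)).1⁻¹) ≤ η := by
    intro α i
    have hc : Continuous fun g : G => (g * (st α (i + 1)).2 i * g⁻¹,
      (st α (i + 1)).1 * (st α (i + 1)).2 i * (st α (i + 1)).1⁻¹) := by fun_prop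
    -- Lower semi-continuity carries the bound to the `τ`-limit.
    refine ((hG.isClosed_le η).preimage hc).mem_of_tendsto (hH α) ?_
    filter_upwards [eventually_ge_atTop (i + 1)] with m hm
    obtain ⟨k, rfl⟩ := Nat.exists_eq_add_of_le hm
    have h0 : (0 : ℝ) ≤ (1 / 2) ^ k := by positivity
    exact (hbound α i k).2.trans (by nlinarith)
  refine ⟨H, fun α β n hlt hα hβ => ?_⟩
  have hagree : ∀ m ≤ n, st α m = st β m := by
    intro m
    induction m with
    | zero => exact fun _ => rfl
    | succ m ih => exact fun hm => by rw [hst, hst, ih (by omega), hlt m (by omega)]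
  have hmn := hmem α n
  have h1 := hlimit α n
  have h2 := hlimit β n
  rw [hst, hα] at h1
  rw [hst, hβ, ← hagree n le_rfl] at h2
  simp only [Bool.false_eq_true, if_false, if_true, Function.update_self] at h1 h2
  have h3 := hfb n (st α n).1 _ hmn
  refine ⟨_, haA n (st α n).1 _ hmn, _, hbB n (st α n).1 _ hmn, ?_⟩
  rw [← hG.conj (st α n).1] at h3
  rw [hG.symm] at h2
  have h4 : ∀ u g x : G, u * (g * x * g⁻¹) * u⁻¹ = u * g * x * (u * g)⁻¹ := by
    intro u g x; group
  rw [h4] at h3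
  have h5 : η * (1 / 2) ^ n ≤ η := mul_le_of_le_one_right hη.le
    (pow_le_one₀ (by norm_num) (by norm_num))
  rw [hG.symm] at h3
  refine (hG.triangle _ _ _).trans_lt ((add_le_add_right (hG.triangle _ _ _) _).trans_lt
    ((add_le_add h1 (add_le_add (h3.le.trans h5) h2)).trans_lt ?_))
  simp only [η]
  linarith

end Steinhaus

/-! ### Pigeonhole and conclusion -/

theorem mainTheorem5 {G : Type*} [Group G] [TopologicalSpace G] [PolishSpace G]
    (d : G → G → ℝ) (hG : IsTopometricGroup d) (hample : HasAmpleGenerics d) :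
    IsSteinhausWithExponent d 10 := by
  have := hG.toIsTopologicalGroup
  intro A hAsymm hA ε hε
  obtain ⟨u, hu⟩ := nonempty_interior_nonmeagreLocus hA.not_isMeagre
  set U := interior (nonmeagreLocus A) with hU
  have hUo : IsOpen U := isOpen_interior
  have hnhds : {g : G | g⁻¹ * u ∈ U} ∈ 𝓝 1 :=
    (hUo.preimage (by fun_prop)).mem_nhds (by simpa using hu)
  refine mem_interior_iff_mem_nhds.2 (mem_of_superset hnhds fun g hg => ?_)
  obtain ⟨H, hH⟩ := hG.exists_conj_cantor hample (A := A) (B := g • A) (hUo.inter (hUo.smul g))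
    ⟨u, hu, g⁻¹ * u, hg, by simp⟩ (inter_subset_left.trans interior_subset)
    (inter_subset_right.trans (smul_subset_nonmeagreLocus_smul g interior_subset)) hε
  obtain ⟨T, hT, hTA⟩ := hA
  have hcov : ∀ x : G, ∃ t : T, ∃ y ∈ A, (t : G) * y = x := by
    intro x
    obtain ⟨t, ht, y, hy, hxy⟩ := mem_iUnion₂.1 (hTA.symm ▸ mem_univ x : x ∈ ⋃ t ∈ T, t • A)
    exact ⟨⟨t, ht⟩, y, hy, hxy⟩
  choose t y hyA hty using hcov
  have := hT.to_subtype
  have huncountable : ¬ Function.Injective fun α => t (H α) := fun hinj => by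
    have hc := Cardinal.mk_le_aleph0_iff.2 hinj.countable
    rw [← not_lt] at hc
    exact hc (by simpa using Cardinal.cantor Cardinal.aleph0)
  obtain ⟨α, β, heq, hne⟩ : ∃ α β, t (H α) = t (H β) ∧ α ≠ β := by
    simpa [Function.Injective] using huncountable
  have key : ∀ (α β : ℕ → Bool) (n : ℕ), t (H α) = t (H β) → (∀ m < n, α m = β m) →
      α n = false → β n = true → g ∈ dThickening d ε (A ^ 10) := by
    intro α β n heq hlt hα hβ
    obtain ⟨a, ha, _, ⟨w, hw, rfl⟩, hd⟩ := hH α β n hlt hα hβ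
    have hinv : ∀ x ∈ A, x⁻¹ ∈ A := fun x hx => by rwa [← Set.mem_inv, hAsymm]
    let p := y (H α)
    let q := y (H β)
    have hp : p ∈ A := hyA _
    have hq : q ∈ A := hyA _
    -- The last four factors cancel and only bring the length from six to ten.
    refine ⟨q⁻¹ * p * a * p⁻¹ * q * w⁻¹ * w * w⁻¹ * w * w⁻¹, ?_, ?_⟩
    · simp only [pow_succ, pow_zero, one_mul]
      repeat' refine Set.mul_mem_mul ?_ ?_
      all_goals first | assumption | exact hinv _ ‹_›
    · rw [← hty (H α), ← hty (H β), heq, hG.symm] at hd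
      rw [← hG.mul_left_invariant ((t (H β) : G) * q),
        ← hG.mul_right_invariant (w * ((t (H β) : G) * q)⁻¹)]
      convert hd using 2
      · simp [q, mul_assoc]
      · simp only [p, q]; group
  have hex : ∃ n, α n ≠ β n := Function.ne_iff.1 hne
  classical
  have hlt : ∀ m < Nat.find hex, α m = β m := fun m hm => not_not.1 (Nat.find_min hex hm)
  have hn := Nat.find_spec hex
  rcases hα : α (Nat.find hex) with _ | _
  · exact key α β _ heq hlt hα (by simpa [hα] using hn)
  · exact key β α _ heq.symm (fun m hm => (hlt m hm).symm) (by simpa [hα] using hn) hα
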